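/- Let $A$ be a finite alphabet, and write $A^*$ (resp. $A^+$) for the set of all (resp. all nonempty) finite words over $A$ and $w^r$ for the reverse of a word $w$. View a word $w=a_1\cdots a_n\in A^*$ as a relational structure with domain $\{1,\dots,n\}$, with a unary predicate $P_a$ for each $a\in A$ that holds exactly at the positions labelled $a$, and with the binary predicate $N(x,y) :\Leftrightarrow (x+1=y \text{ or } y+1=x)$. A language $L\subseteq A^*$ is *$\mathrm{FO}(N)$-definable* if there is a first-order sentence $\varphi$ (with equality) over the predicates $P_a$ ($a\in A$) and $N$ such that $L=\{w\in A^* : w\models\varphi\}$; such a language satisfies $L=\{w^r : w\in L\}$. Let $\sim_L$ be the syntactic congruence of $L$: $x\sim_L y$ if and only if, for all $u,v\in A^*$, $uxv\in L\Leftrightarrow uyv\in L$. The *syntactic $\star$-semigroup* of $L$ is the quotient semigroup $A^+/{\sim_L}$ with the involution $[w]^\star=[w^r]$, which is well defined because $L$ is closed under reverse. **Theorem.** If $L\subseteq A^*$ is $\mathrm{FO}(N)$-definable, then its syntactic $\star$-semigroup satisfies $$e\,x\,e^\star = e\,x^\star\,e^\star$$ for every idempotent $e$ and every element $x$ of it.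 -/

import Mathlib

/-- The relation symbols of `FO(N)` over the alphabet `A`: a unary predicate `P_a` for each letter
`a`, and the binary predicate `N`.  (Equality is a logical symbol of first-order logic.) -/
inductive NeighbourRel (A : Type*) : ℕ → Type _
  | letter (a : A) : NeighbourRel A 1
  | neighbour : NeighbourRel A 2

/-- The relational vocabulary of `FO(N)` over the alphabet `A`. -/
def neighbourLang (A : Type*) : FirstOrder.Language where
  Functions := fun _ => Empty
  Relations := NeighbourRel A

/-- The positions of a word. -/
def Position {A : Type*} (w : List A) : Type := Fin w.length

/-- A word as a structure on its positions: `P_a` holds at the positions labelled `a`, and `N` holds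
for two positions one of which is the successor of the other. -/
instance Position.structure {A : Type*} (w : List A) :
    (neighbourLang A).Structure (Position w) where
  funMap := fun f => nomatch f
  RelMap := fun {_} R => match R with
    | .letter a => fun x : Fin 1 → Fin w.length => w.get (x 0) = a
    | .neighbour => fun x : Fin 2 → Fin w.length =>
        (x 0).val + 1 = (x 1).val ∨ (x 1).val + 1 = (x 0).val

/-- `L` is `FO(N)`-definable: it is the set of words satisfying some sentence of `FO(N)`. -/
def IsFONDefinable {A : Type*} (L : Language A) : Prop :=
  ∃ φ : (neighbourLang A).Sentence,
    ∀ w : List A, w ∈ L ↔ FirstOrder.Language.Sentence.Realize (Position w) φ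

/-- `L` is closed under reversing words. -/
def IsReversible {A : Type*} (L : Language A) : Prop :=
  L.reverse = L

theorem get_reverse_rev {A : Type*} (w : List A) (i : Fin w.length) :
    w.reverse.get (finCongr (List.length_reverse (as := w)).symm (Fin.revPerm i)) = w.get i := by
  have h2 : w.length - 1 - (w.length - (i.val + 1)) = i.val := by omega
  simp [Fin.val_rev, h2]

theorem neighbour_rev {n : ℕ} (i j : Fin n) :
    ((Fin.rev i).val + 1 = (Fin.rev j).val ∨ (Fin.rev j).val + 1 = (Fin.rev i).val) ↔
      (i.val + 1 = j.val ∨ j.val + 1 = i.val) := by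
  simp only [Fin.val_rev]
  omega

/-- Reversing positions is an isomorphism from the structure of a word to that of its reverse. -/
def Position.revEquiv {A : Type*} (w : List A) :
    FirstOrder.Language.Equiv (neighbourLang A) (Position w) (Position w.reverse) where
  toEquiv := (Fin.revPerm (n := w.length)).trans (finCongr (List.length_reverse (as := w)).symm)
  map_fun' := fun f => nomatch f
  map_rel' := by
    intro n R x
    cases R with
    | letter a => exact Iff.of_eq (congrArg (· = a) (get_reverse_rev w (x 0)))
    | neighbour => exact neighbour_rev (n := w.length) (x 0) (x 1)

theorem IsFONDefinable.isReversible {A : Type*} {L : Language A} (hL : IsFONDefinable L) :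
    IsReversible L := by
  obtain ⟨φ, hφ⟩ := hL
  refine Set.ext fun w => ?_
  change w.reverse ∈ L ↔ w ∈ L
  rw [hφ, hφ]
  exact (FirstOrder.Language.StrongHomClass.realize_sentence (Position.revEquiv w) φ).symm

/-- The free semigroup `A⁺` of nonempty words. -/
def NonemptyWord (A : Type*) : Type _ := {w : List A // w ≠ []}

instance NonemptyWord.semigroup (A : Type*) : Semigroup (NonemptyWord A) where
  mul x y := ⟨x.1 ++ y.1, by simp [x.2]⟩
  mul_assoc x y z := Subtype.ext (List.append_assoc x.1 y.1 z.1)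

/-- `A⁺` with word reversal is a `⋆`-semigroup. -/
instance NonemptyWord.starMul (A : Type*) : StarMul (NonemptyWord A) where
  star x := ⟨x.1.reverse, by simp [x.2]⟩
  star_involutive x := Subtype.ext (List.reverse_reverse x.1)
  star_mul x y := Subtype.ext (List.reverse_append (as := x.1) (bs := y.1))

/-- The syntactic congruence `∼_L`, on `A⁺`. Contexts range over `A*`. -/
def syntacticCon {A : Type*} (L : Language A) : Con (NonemptyWord A) where
  r x y := ∀ u v : List A, u ++ x.1 ++ v ∈ L ↔ u ++ y.1 ++ v ∈ L
  iseqv :=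
    { refl := fun _ _ _ => Iff.rfl
      symm := fun h u v => (h u v).symm
      trans := fun h k u v => (h u v).trans (k u v) }
  mul' := by
    intro w x y z h k u v
    change u ++ (w.1 ++ y.1) ++ v ∈ L ↔ u ++ (x.1 ++ z.1) ++ v ∈ L
    have h1 := h u (y.1 ++ v)
    have h2 := k (u ++ x.1) v
    simp only [List.append_assoc] at h1 h2 ⊢
    exact h1.trans h2

theorem syntacticCon_star {A : Type*} {L : Language A} (hL : IsReversible L)
    {x y : NonemptyWord A} (h : syntacticCon L x y) : syntacticCon L (star x) (star y) := by
  have key : ∀ w : List A, w.reverse ∈ L ↔ w ∈ L := fun w => by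
    conv_rhs => rw [← show L.reverse = L from hL]
    exact Iff.rfl
  intro u v
  change u ++ x.1.reverse ++ v ∈ L ↔ u ++ y.1.reverse ++ v ∈ L
  rw [← key (u ++ x.1.reverse ++ v), ← key (u ++ y.1.reverse ++ v)]
  simpa using h v.reverse u.reverse

/-- The syntactic `⋆`-semigroup `A⁺ / ∼_L` of a reversible language `L`. -/
def SyntacticStarSemigroup {A : Type*} (L : Language A) (_hL : IsReversible L) : Type _ :=
  (syntacticCon L).Quotient

instance SyntacticStarSemigroup.semigroup {A : Type*} (L : Language A) (hL : IsReversible L) :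
    Semigroup (SyntacticStarSemigroup L hL) :=
  inferInstanceAs (Semigroup (syntacticCon L).Quotient)

/-- The canonical morphism `A⁺ → A⁺ / ∼_L`. -/
def SyntacticStarSemigroup.mk {A : Type*} (L : Language A) (hL : IsReversible L) :
    NonemptyWord A → SyntacticStarSemigroup L hL :=
  fun w => ((w : (syntacticCon L).Quotient))

/-- The involution of the syntactic `⋆`-semigroup: `[w]⋆ = [wʳ]`. -/
instance SyntacticStarSemigroup.starMul {A : Type*} (L : Language A) (hL : IsReversible L) :
    StarMul (SyntacticStarSemigroup L hL) where
  star := Quotient.map (fun w : NonemptyWord A => star w) fun _ _ h => syntacticCon_star hL h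
  star_involutive := by
    rintro ⟨x⟩
    exact congrArg (SyntacticStarSemigroup.mk L hL) (star_star x)
  star_mul := by
    rintro ⟨x⟩ ⟨y⟩
    exact congrArg (SyntacticStarSemigroup.mk L hL) (star_mul x y)

/-! This is an Ehrenfeucht–Fraïssé argument. An idempotent `e` has representatives `p` of any
length, and `p xʳ pʳ` is the reverse of `p x pʳ`. So it suffices that a sentence cannot detect the
reversal of a factor `p x pʳ` inside `u p x pʳ v` once `p` is long.

Two bijections compare the words: the identity on positions, which respects letters except perhaps
in the central `x`, and the reflection of the factor, which respects letters and `N` inside the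
factor. Both preserve the depth in the factor. Using the identity up to depth `a` and the reflection
beyond gives a bijection that can violate `N` only between depths `a` and `a + 1`. As `N` is
symmetric, reversed orientation is visible only there.

The threshold `a` is kept in a gap of depths free of chosen points. Each quantifier costs half of
the gap, so a gap of sufficient width, hence a long enough `p`, settles any given sentence
(`DepthMatching.exists_realize_glue_iff`). -/

/-! ### Gluing two depth-preserving bijections -/

/-- The position as an element of `Fin w.length`. -/
def Position.index {A : Type*} {w : List A} (p : Position w) : Fin w.length := p

/-- The relation `N` on the positions of a word. -/
def Position.Neighbour {A : Type*} {w : List A} (p q : Position w) : Prop :=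
  p.index.val + 1 = q.index.val ∨ q.index.val + 1 = p.index.val

/-- Two bijections `outer` and `inner` between the positions of two words that preserve a common
notion of depth, such that neighbours differ in depth by at most one, `outer` preserves neighbourhood
everywhere and letters up to depth `K`, and `inner` preserves both from depth one on. -/
structure DepthMatching {A : Type*} (w₁ w₂ : List A) (K : ℕ) where
  outer : Position w₁ ≃ Position w₂
  inner : Position w₁ ≃ Position w₂
  depth₁ : Position w₁ → ℕ
  depth₂ : Position w₂ → ℕ
  depth_outer : ∀ p, depth₂ (outer p) = depth₁ p
  depth_inner : ∀ p, depth₂ (inner p) = depth₁ p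
  get_outer : ∀ p, depth₁ p ≤ K → w₂.get (outer p).index = w₁.get p.index
  get_inner : ∀ p, 1 ≤ depth₁ p → w₂.get (inner p).index = w₁.get p.index
  neighbour_outer : ∀ p q, (outer p).Neighbour (outer q) ↔ p.Neighbour q
  neighbour_inner : ∀ p q, 1 ≤ depth₁ p → 1 ≤ depth₁ q →
    ((inner p).Neighbour (inner q) ↔ p.Neighbour q)
  depth₁_le : ∀ p q, p.Neighbour q → depth₁ p ≤ depth₁ q + 1
  depth₂_le : ∀ p q, p.Neighbour q → depth₂ p ≤ depth₂ q + 1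

/-- The map that follows `outer` up to depth `a` and `inner` beyond. -/
def DepthMatching.glue {A : Type*} {w₁ w₂ : List A} {K : ℕ} (m : DepthMatching w₁ w₂ K) (a : ℕ)
    (p : Position w₁) : Position w₂ :=
  if m.depth₁ p ≤ a then m.outer p else m.inner p

theorem Position.Neighbour.symm {A : Type*} {w : List A} {p q : Position w} (h : p.Neighbour q) :
    q.Neighbour p := Or.symm h

theorem Position.neighbour_comm {A : Type*} {w : List A} (p q : Position w) :
    p.Neighbour q ↔ q.Neighbour p := or_comm

theorem neighbourLang.exists_eq_var {A α : Type*} (t : (neighbourLang A).Term α) :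
    ∃ i, t = FirstOrder.Language.Term.var i := by
  rcases t with i | ⟨F, -⟩
  · exact ⟨i, rfl⟩
  · exact nomatch F

namespace DepthMatching

variable {A : Type*} {w₁ w₂ : List A} {K : ℕ} (m : DepthMatching w₁ w₂ K)

theorem depth_glue (a : ℕ) (p : Position w₁) : m.depth₂ (m.glue a p) = m.depth₁ p := by
  unfold glue
  split_ifs
  · exact m.depth_outer p
  · exact m.depth_inner p

theorem glue_of_le {a : ℕ} {p : Position w₁} (h : m.depth₁ p ≤ a) : m.glue a p = m.outer p :=
  if_pos h

theorem glue_of_lt {a : ℕ} {p : Position w₁} (h : a < m.depth₁ p) : m.glue a p = m.inner p :=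
  if_neg h.not_ge

/-- Both bijections preserve depth, so points with the same image lie on the same side of the
threshold. -/
theorem glue_injective (a : ℕ) : Function.Injective (m.glue a) := by
  intro p q h
  have hd : m.depth₁ p = m.depth₁ q := by rw [← m.depth_glue a, h, m.depth_glue]
  rcases le_or_gt (m.depth₁ p) a with hp | hp
  · rw [m.glue_of_le hp, m.glue_of_le (hd ▸ hp)] at h
    exact m.outer.injective h
  · rw [m.glue_of_lt hp, m.glue_of_lt (hd ▸ hp)] at h
    exact m.inner.injective h

theorem glue_surjective (a : ℕ) : Function.Surjective (m.glue a) := by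
  intro z
  rcases le_or_gt (m.depth₂ z) a with hz | hz
  · refine ⟨m.outer.symm z, ?_⟩
    rw [m.glue_of_le, m.outer.apply_symm_apply]
    rwa [← m.depth_outer, m.outer.apply_symm_apply]
  · refine ⟨m.inner.symm z, ?_⟩
    rw [m.glue_of_lt, m.inner.apply_symm_apply]
    rwa [← m.depth_inner, m.inner.apply_symm_apply]

theorem get_glue {a : ℕ} (ha : a ≤ K) (p : Position w₁) :
    w₂.get (m.glue a p).index = w₁.get p.index := by
  rcases le_or_gt (m.depth₁ p) a with hp | hp
  · rw [m.glue_of_le hp, m.get_outer p (hp.trans ha)]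
  · rw [m.glue_of_lt hp, m.get_inner p (by omega)]

/-- Points on the same side are moved by the same bijection. Points on opposite sides differ in
depth by at least two, as do their images, so neither pair is adjacent. -/
theorem neighbour_glue {a b : ℕ} (hab : a + 2 ≤ b) {p q : Position w₁}
    (hp : m.depth₁ p ≤ a ∨ b ≤ m.depth₁ p) (hq : m.depth₁ q ≤ a ∨ b ≤ m.depth₁ q) :
    (m.glue a p).Neighbour (m.glue a q) ↔ p.Neighbour q := by
  have far : ∀ p q, m.depth₁ p + 2 ≤ m.depth₁ q →
      ((m.glue a p).Neighbour (m.glue a q) ↔ p.Neighbour q) := by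
    refine fun p q h => iff_of_false (fun hn => ?_) fun hn => ?_
    · have := m.depth₂_le _ _ hn.symm
      rw [m.depth_glue, m.depth_glue] at this
      omega
    · have := m.depth₁_le _ _ hn.symm
      omega
  by_cases h : m.depth₁ p ≤ a <;> by_cases h' : m.depth₁ q ≤ a
  · rw [m.glue_of_le h, m.glue_of_le h', m.neighbour_outer]
  · exact far p q (by omega)
  · rw [Position.neighbour_comm, Position.neighbour_comm p]
    exact far q p (by omega)
  · rw [m.glue_of_lt (by omega), m.glue_of_lt (by omega), m.neighbour_inner p q]
    all_goals omega

end DepthMatching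

/-! ### Invariance of formulas under gluing -/

/-- For every formula of `FO(N)` there is a width such that gluing along a gap of at least that width
in which no free variable is placed preserves the formula. -/
theorem DepthMatching.exists_realize_glue_iff {A : Type*} {n : ℕ}
    (φ : (neighbourLang A).BoundedFormula Empty n) :
    ∃ R : ℕ, 2 ≤ R ∧ ∀ {w₁ w₂ : List A} {K : ℕ} (m : DepthMatching w₁ w₂ K) (a b : ℕ),
      a + R ≤ b → b ≤ K → ∀ v : Fin n → Position w₁, (∀ i, m.depth₁ (v i) ≤ a ∨ b ≤ m.depth₁ (v i)) →
        (φ.Realize default (m.glue a ∘ v) ↔ φ.Realize default v) := by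
  induction φ with
  | falsum => exact ⟨2, le_rfl, by intros; rfl⟩
  | equal t₁ t₂ =>
    refine ⟨2, le_rfl, ?_⟩
    intro w₁ w₂ K m a b hab _ v hv
    obtain ⟨⟨⟨⟩⟩ | i, rfl⟩ := neighbourLang.exists_eq_var t₁
    obtain ⟨⟨⟨⟩⟩ | j, rfl⟩ := neighbourLang.exists_eq_var t₂
    exact (m.glue_injective a).eq_iff (a := v i) (b := v j)
  | rel R ts =>
    refine ⟨2, le_rfl, ?_⟩
    intro w₁ w₂ K m a b hab hbK v hv
    cases R with
    | letter c =>
      obtain ⟨⟨⟨⟩⟩ | i, hi⟩ := neighbourLang.exists_eq_var (ts 0)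
      change w₂.get (Position.index (FirstOrder.Language.Term.realize _ (ts 0))) = c ↔
        w₁.get (Position.index (FirstOrder.Language.Term.realize _ (ts 0))) = c
      rw [hi]
      exact iff_of_eq (congrArg (· = c) (m.get_glue (by omega) (v i)))
    | neighbour =>
      obtain ⟨⟨⟨⟩⟩ | i, hi⟩ := neighbourLang.exists_eq_var (ts 0)
      obtain ⟨⟨⟨⟩⟩ | j, hj⟩ := neighbourLang.exists_eq_var (ts 1)
      change Position.Neighbour (w := w₂) (FirstOrder.Language.Term.realize _ (ts 0))
          (FirstOrder.Language.Term.realize _ (ts 1)) ↔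
        Position.Neighbour (w := w₁) (FirstOrder.Language.Term.realize _ (ts 0))
          (FirstOrder.Language.Term.realize _ (ts 1))
      rw [hi, hj]
      exact m.neighbour_glue hab (hv i) (hv j)
  | imp φ ψ ihφ ihψ =>
    obtain ⟨R, hR, hφ⟩ := ihφ
    obtain ⟨S, hS, hψ⟩ := ihψ
    refine ⟨R + S, by omega, ?_⟩
    intro w₁ w₂ K m a b hab hbK v hv
    exact imp_congr (hφ m a b (by omega) hbK v hv) (hψ m a b (by omega) hbK v hv)
  | @all n φ ih =>
    obtain ⟨R, hR, hφ⟩ := ih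
    refine ⟨R + R, by omega, ?_⟩
    intro w₁ w₂ K m a b hab hbK v hv
    -- A new point `z` spoils at most one half of a gap of width `R + R`; the half from `c` to `c +
    -- R` stays free. Moving the threshold from `a` to `c` does not affect the old points, none of
    -- which lies in the gap.
    have key : ∀ z, ∀ c, (m.depth₁ z ≤ a + R ∧ c = a + R ∨ a + R < m.depth₁ z ∧ c = a) →
        (φ.Realize default (Fin.snoc (m.glue a ∘ v) (m.glue c z)) ↔
          φ.Realize default (Fin.snoc v z : Fin (n + 1) → Position w₁)) := by
      intro z c hc
      rw [← hφ m c (c + R) le_rfl (by omega) (Fin.snoc v z), Fin.comp_snoc]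
      · have : m.glue a ∘ v = m.glue c ∘ v := by
          funext i
          rcases hv i with h | h
          · exact (m.glue_of_le h).trans (m.glue_of_le (by omega)).symm
          · exact (m.glue_of_lt (by omega)).trans (m.glue_of_lt (by omega)).symm
        rw [this]
      · refine Fin.lastCases ?_ (fun i => ?_)
        · rw [Fin.snoc_last]
          omega
        · rw [Fin.snoc_castSucc]
          have := hv i
          omega
    rw [FirstOrder.Language.BoundedFormula.realize_all,
      FirstOrder.Language.BoundedFormula.realize_all]
    refine ⟨fun h z => ?_, fun h z => ?_⟩
    · rcases le_or_gt (m.depth₁ z) (a + R) with hz | hz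
      · exact (key z _ (Or.inl ⟨hz, rfl⟩)).1 (h _)
      · exact (key z _ (Or.inr ⟨hz, rfl⟩)).1 (h _)
    -- Gluing preserves depth, so the depth of `z` already tells which threshold to use for its
    -- preimage.
    · rcases le_or_gt (m.depth₂ z) (a + R) with hz | hz
      · obtain ⟨y, rfl⟩ := m.glue_surjective (a + R) z
        rw [m.depth_glue] at hz
        exact (key y _ (Or.inl ⟨hz, rfl⟩)).2 (h _)
      · obtain ⟨y, rfl⟩ := m.glue_surjective a z
        rw [m.depth_glue] at hz
        exact (key y _ (Or.inr ⟨hz, rfl⟩)).2 (h _)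

/-! ### Reversing a factor of a word -/

/-- The involution of `Fin N` that reverses the factor of length `m` starting at position `n`. -/
def reflectFactor (n m N : ℕ) (h : n + m ≤ N) : Equiv.Perm (Fin N) :=
  Function.Involutive.toPerm
    (fun i => ⟨if n ≤ i.val ∧ i.val < n + m then n + (n + m) - 1 - i.val else i.val, by
      have := i.2
      split_ifs <;> omega⟩)
    (fun i => by
      refine Fin.ext ?_
      dsimp only
      split_ifs <;> omega)

theorem reflectFactor_val {n m N : ℕ} (h : n + m ≤ N) (i : Fin N) :
    (reflectFactor n m N h i).val =
      if n ≤ i.val ∧ i.val < n + m then n + (n + m) - 1 - i.val else i.val := rfl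

theorem getElem?_reverse_factor {A : Type*} (u w v : List A) {i : ℕ} (h₁ : u.length ≤ i)
    (h₂ : i < u.length + w.length) :
    (u ++ w.reverse ++ v)[u.length + (u.length + w.length) - 1 - i]? = (u ++ w ++ v)[i]? := by
  rw [List.append_assoc, List.append_assoc, List.getElem?_append_right (by omega),
    List.getElem?_append_right h₁, List.getElem?_append_left (by simp; omega),
    List.getElem?_append_left (by omega), List.getElem?_reverse (by omega)]
  congr 1
  omega

theorem getElem?_replace_factor {A : Type*} (u x y v : List A) (hxy : x.length = y.length) {i : ℕ}
    (h : i < u.length ∨ u.length + x.length ≤ i) :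
    (u ++ x ++ v)[i]? = (u ++ y ++ v)[i]? := by
  rw [List.append_assoc, List.append_assoc]
  rcases h with h | h
  · rw [List.getElem?_append_left h, List.getElem?_append_left h]
  · rw [List.getElem?_append_right (by omega), List.getElem?_append_right (by omega),
      List.getElem?_append_right (by omega), List.getElem?_append_right (by omega), hxy]

theorem List.get_eq_get_of_getElem? {A : Type*} {l₁ l₂ : List A} (i : Fin l₁.length)
    (j : Fin l₂.length) (h : l₂[j.val]? = l₁[i.val]?) : l₂.get j = l₁.get i := by
  rw [List.getElem?_eq_getElem i.2, List.getElem?_eq_getElem j.2] at h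
  exact Option.some.inj h

/-- Reversing the middle factor `p x pʳ` of `u p x pʳ v` keeps the letters at depth at most `|p|` in
place. The depth of a position is its distance to the complement of that factor. -/
def DepthMatching.reverseFactor {A : Type*} (p x u v : List A) :
    DepthMatching (u ++ (p ++ x ++ p.reverse) ++ v) (u ++ (p ++ x ++ p.reverse).reverse ++ v)
      p.length :=
  have hlen : (u ++ (p ++ x ++ p.reverse) ++ v).length =
      (u ++ (p ++ x ++ p.reverse).reverse ++ v).length := by
    simp only [List.length_append, List.length_reverse]
  have hfac : u.length + (p ++ x ++ p.reverse).length ≤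
      (u ++ (p ++ x ++ p.reverse) ++ v).length := by
    simp only [List.length_append]
    omega
  have hrefl := reflectFactor_val hfac
  { outer := finCongr hlen
    inner := (reflectFactor u.length (p ++ x ++ p.reverse).length _ hfac).trans (finCongr hlen)
    -- Truncated subtraction makes the depth `0` outside the factor; it is `1` at both ends of the
    -- factor.
    depth₁ := fun i => min (i.index.val + 1 - u.length)
      (u.length + (p ++ x ++ p.reverse).length - i.index.val)
    depth₂ := fun i => min (i.index.val + 1 - u.length)
      (u.length + (p ++ x ++ p.reverse).length - i.index.val)
    depth_outer := fun _ => rfl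
    depth_inner := by
      intro (i : Fin _)
      change min ((reflectFactor _ _ _ hfac i).val + 1 - _)
        (_ - (reflectFactor _ _ _ hfac i).val) = min (i.val + 1 - _) (_ - i.val)
      rw [hrefl]
      split_ifs <;> omega
    get_outer := by
      intro i hi
      refine List.get_eq_get_of_getElem? i.index (finCongr hlen i.index) ?_
      change _[i.index.val]? = _
      generalize i.index.val = k at hi
      have hpx : (p ++ x ++ p.reverse).length = p.length + x.length + p.length := by
        simp only [List.length_append, List.length_reverse]
      have hup : (u ++ p).length = u.length + p.length := List.length_append
      -- Depth at most `|p|` keeps `k` out of the central `x`, the only part where the two words can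
      -- differ.
      have := getElem?_replace_factor (u ++ p) x.reverse x (p.reverse ++ v) List.length_reverse
        (i := k) (by rw [List.length_reverse]; omega)
      simpa only [List.reverse_append, List.reverse_reverse, List.append_assoc] using this
    get_inner := by
      intro i hi
      refine List.get_eq_get_of_getElem? i.index
        (finCongr hlen (reflectFactor _ _ _ hfac i.index)) ?_
      change _[(reflectFactor _ _ _ hfac i.index).val]? = _
      rw [hrefl, if_pos (by omega)]
      exact getElem?_reverse_factor u _ v (by omega) (by omega)
    neighbour_outer := fun _ _ => Iff.rfl
    neighbour_inner := by
      intro i j hi hj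
      change ((reflectFactor _ _ _ hfac i.index).val + 1 = (reflectFactor _ _ _ hfac j.index).val ∨
        (reflectFactor _ _ _ hfac j.index).val + 1 = (reflectFactor _ _ _ hfac i.index).val) ↔
          (i.index.val + 1 = j.index.val ∨ j.index.val + 1 = i.index.val)
      rw [hrefl, hrefl, if_pos (by omega), if_pos (by omega)]
      omega
    depth₁_le := by
      intro i j (h : _ ∨ _)
      omega
    depth₂_le := by
      intro i j (h : _ ∨ _)
      omega }

/-- A `FO(N)`-definable language does not distinguish a factor `x` from its reverse when it stands
between a long enough word and the reverse of that word. -/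
theorem IsFONDefinable.exists_mem_iff_reverse_mem {A : Type*} {L : Language A}
    (hL : IsFONDefinable L) : ∃ R : ℕ, ∀ p : List A, R ≤ p.length → ∀ x u v : List A,
      u ++ (p ++ x ++ p.reverse) ++ v ∈ L ↔ u ++ (p ++ x.reverse ++ p.reverse) ++ v ∈ L := by
  obtain ⟨φ, hφ⟩ := hL
  obtain ⟨R, -, hR⟩ := DepthMatching.exists_realize_glue_iff φ
  refine ⟨R, fun p hp x u v => ?_⟩
  have hrev : p ++ x.reverse ++ p.reverse = (p ++ x ++ p.reverse).reverse := by
    simp only [List.reverse_append, List.reverse_reverse, List.append_assoc]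
  rw [hrev, hφ, hφ]
  -- A sentence has no free variables, so the whole range of depths from `0` to `|p|` serves as the
  -- gap.
  have := hR (DepthMatching.reverseFactor p x u v) 0 p.length (by omega) le_rfl default
    (fun i => i.elim0)
  refine this.symm.trans (iff_of_eq (congrArg _ ?_))
  exact Subsingleton.elim _ _

/-! ### Idempotents and the identity -/

/-- An idempotent of the syntactic semigroup is represented by arbitrarily long words. -/
theorem SyntacticStarSemigroup.exists_long_mk_eq {A : Type*} {L : Language A} (hL : IsReversible L)
    {e : SyntacticStarSemigroup L hL} (he : IsIdempotentElem e) (n : ℕ) :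
    ∃ p : NonemptyWord A, mk L hL p = e ∧ n ≤ p.1.length := by
  induction n with
  | zero =>
    obtain ⟨p⟩ := e
    exact ⟨p, rfl, Nat.zero_le _⟩
  | succ n ih =>
    obtain ⟨p, hp, hn⟩ := ih
    -- Squaring keeps the class, by idempotence, and lengthens the word, which is nonempty.
    refine ⟨p * p, (congrArg₂ (· * ·) hp hp).trans he, ?_⟩
    change n + 1 ≤ (p.1 ++ p.1).length
    have := List.length_pos_of_ne_nil p.2
    rw [List.length_append]
    omega

theorem mainTheorem2 {A : Type*} [Finite A] {L : Language A} (hL : IsFONDefinable L)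
    (e x : SyntacticStarSemigroup L hL.isReversible) (he : IsIdempotentElem e) :
    e * x * star e = e * star x * star e := by
  obtain ⟨R, hR⟩ := hL.exists_mem_iff_reverse_mem
  obtain ⟨p, rfl, hp⟩ := SyntacticStarSemigroup.exists_long_mk_eq hL.isReversible he R
  obtain ⟨x⟩ := x
  exact (Con.eq (syntacticCon L)).2 fun u v => hR p.1 hp x.1 u v
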